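/- Let $n,d\in\mathbb{N}$, $\mathbf{A}\in\mathbb{R}^{d\times n}$, $\mathbf{y}\in\mathbb{R}^d$, let $\sigma,\beta,\rho>0$, and let $g:\mathbb{R}^n\to\mathbb{R}$. Put $$\mathbf{Q}=\frac{1}{\sigma^2}\mathbf{A}^\top\mathbf{A}+\frac{1}{\rho^2}\mathbf{I}_n,\qquad \boldsymbol{\mu}(\mathbf{z})=\mathbf{Q}^{-1}\Big(\frac{1}{\sigma^2}\mathbf{A}^\top\mathbf{y}+\frac{1}{\rho^2}\mathbf{z}\Big).$$ For $\gamma>0$ let $P_{\rho,\gamma}$ be the Markov kernel on $\mathbb{R}^n\times\mathbb{R}^n$ (with its Euclidean norm) of the Langevin-within-split-Gibbs sampler: from $\mathbf{v}=(\mathbf{x},\mathbf{z})$ it first draws $$\tilde{\mathbf{z}}\sim\mathcal{N}\Big(\big(1-\tfrac{\gamma}{\rho^2}\big)\mathbf{z}+\tfrac{\gamma}{\rho^2}\mathbf{x}-\gamma\beta\nabla g(\mathbf{z}),\;2\gamma\mathbf{I}_n\Big),$$ which is one Langevin step for the density proportional to $\mathbf{z}\mapsto\exp[-\beta g(\mathbf{z})-\frac{1}{2\rho^2}\|\mathbf{x}-\mathbf{z}\|^2]$,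 then draws $\tilde{\mathbf{x}}$ from the Gaussian distribution with mean $\boldsymbol{\mu}(\tilde{\mathbf{z}})$ and covariance $\mathbf{Q}^{-1}$, and moves to $(\tilde{\mathbf{x}},\tilde{\mathbf{z}})$. Let $W_2$ denote the Wasserstein distance of order 2 for the Euclidean norm, and $\|\cdot\|$ on matrices the spectral norm. Assume that $g$ is twice continuously differentiable and that there are $M_g>0$ and $m_g>0$ such that $\|\nabla^2 g(\mathbf{z})\|\le M_g$ and $m_g\mathbf{I}_n\preceq\nabla^2 g(\mathbf{z})$ for all $\mathbf{z}\in\mathbb{R}^n$. Let $\gamma>0$ satisfy $\gamma\le(\beta M_g+1/\rho^2)^{-1}$. Then $P_{\rho,\gamma}$ has a unique stationary probability distribution $\pi_{\rho,\gamma}$, and $\pi_{\rho,\gamma}$ has a finite second moment. Moreover, for every $\mathbf{v}\in\mathbb{R}^n\times\mathbb{R}^n$ and every integer $t\ge 1$, the distribution $\delta_{\mathbf{v}}P_{\rho,\gamma}^t$ has a finite second moment and $$W_2^2(\delta_{\mathbf{v}}P_{\rho,\gamma}^t,\pi_{\rho,\gamma})\le C_1\,(1-\gamma\beta m_g)^{2(t-1)}\,W_2^2(\delta_{\mathbf{v}},\pi_{\rho,\gamma}),\qquad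 C_1=1+\Big\|\frac{1}{\rho^2}\mathbf{Q}^{-1}\Big\|^2 .$$ -/

import Mathlib

open MeasureTheory ProbabilityTheory
open scoped ENNReal RealInnerProductSpace MatrixOrder

noncomputable section

namespace LwSGS

/-! ### Wasserstein distance of order two -/

/-- The transport plans (couplings) of two measures. -/
def transportPlans {X : Type*} [MeasurableSpace X] (μ ν : Measure X) : Set (Measure (X × X)) :=
  {ζ | ζ.fst = μ ∧ ζ.snd = ν}

/-- The Wasserstein distance of order two, with values in `[0, ∞]`. It is finite when both
measures are probability measures with finite second moments. -/
def W2 {X : Type*} [PseudoEMetricSpace X] [MeasurableSpace X] (μ ν : Measure X) : ℝ≥0∞ :=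
  (⨅ ζ ∈ transportPlans μ ν, ∫⁻ p, edist p.1 p.2 ^ 2 ∂ζ) ^ (1 / 2 : ℝ)

/-! ### Spaces, Hessian -/

/-- `ℝⁿ` with its Euclidean norm. -/
abbrev E (n : ℕ) : Type := EuclideanSpace ℝ (Fin n)

/-- `ℝⁿ × ℝⁿ` with its Euclidean norm, `‖(x, z)‖² = ‖x‖² + ‖z‖²`. -/
abbrev State (n : ℕ) : Type := WithLp 2 (E n × E n)

/-- The Hessian `∇²g(z)` as a linear operator of `ℝⁿ`: the derivative of the gradient. -/
def hessian {n : ℕ} (g : E n → ℝ) (z : E n) : E n →L[ℝ] E n :=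
  fderiv ℝ (gradient g) z

/-! ### Gaussian kernel -/

theorem measurable_multivariateGaussian {n : ℕ} (S : Matrix (Fin n) (Fin n) ℝ) :
    Measurable (fun a : E n => multivariateGaussian a S) := by
  refine Measure.measurable_of_measurable_coe _ fun s hs => ?_
  have h : ∀ a : E n, multivariateGaussian a S s
      = stdGaussian (E n)
        (Prod.mk a ⁻¹' {p : E n × E n |
          p.1 + Matrix.toEuclideanCLM (𝕜 := ℝ) (CFC.sqrt S) p.2 ∈ s}) := by
    intro a
    rw [multivariateGaussian, Measure.map_apply (by fun_prop) hs]
    rfl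
  simp_rw [h]
  refine measurable_measure_prodMk_left ?_
  have : Measurable
      (fun p : E n × E n => p.1 + Matrix.toEuclideanCLM (𝕜 := ℝ) (CFC.sqrt S) p.2) := by
    fun_prop
  exact this hs

/-- The kernel `a ↦ 𝒩(a, S)`, where `S` is the covariance matrix. -/
def gaussianKernel {n : ℕ} (S : Matrix (Fin n) (Fin n) ℝ) : Kernel (E n) (E n) where
  toFun a := multivariateGaussian a S
  measurable' := measurable_multivariateGaussian S

/-! ### Exact sampling of `x` given `z` -/

/-- The precision matrix `Q = σ⁻² AᵀA + ρ⁻² I`. -/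
def precision {n d : ℕ} (A : Matrix (Fin d) (Fin n) ℝ) (σ ρ : ℝ) : Matrix (Fin n) (Fin n) ℝ :=
  (1 / σ ^ 2) • (A.transpose * A) + (1 / ρ ^ 2) • (1 : Matrix (Fin n) (Fin n) ℝ)

/-- The conditional mean `μ(z) = Q⁻¹ (σ⁻² Aᵀy + ρ⁻² z)`. -/
def condMean {n d : ℕ} (A : Matrix (Fin d) (Fin n) ℝ) (y : E d) (σ ρ : ℝ) (z : E n) : E n :=
  Matrix.toEuclideanCLM (𝕜 := ℝ) (precision A σ ρ)⁻¹
    ((1 / σ ^ 2) • Matrix.toEuclideanLin A.transpose y + (1 / ρ ^ 2) • z)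

theorem measurable_condMean {n d : ℕ} (A : Matrix (Fin d) (Fin n) ℝ) (y : E d) (σ ρ : ℝ) :
    Measurable (condMean A y σ ρ) := by
  unfold condMean
  fun_prop

/-- The kernel `z ↦ 𝒩(μ(z), Q⁻¹)`. -/
def xKernel {n d : ℕ} (A : Matrix (Fin d) (Fin n) ℝ) (y : E d) (σ ρ : ℝ) :
    Kernel (E n) (E n) :=
  (gaussianKernel (precision A σ ρ)⁻¹).comap (condMean A y σ ρ) (measurable_condMean A y σ ρ)

/-! ### Langevin step for `z` given `x` -/

/-- Logarithm of the unnormalised conditional density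
`p(z | x) ∝ exp (-β g(z) - ‖x - z‖² / (2ρ²))`. -/
def logCondDensity {n : ℕ} (g : E n → ℝ) (β ρ : ℝ) (x z : E n) : ℝ :=
  -(β * g z) - 1 / (2 * ρ ^ 2) * ‖x - z‖ ^ 2

/-- The mean `(1 - γ/ρ²) z + (γ/ρ²) x - γβ ∇g(z)` of the Langevin step. -/
def langevinMean {n : ℕ} (g : E n → ℝ) (β ρ γ : ℝ) (v : E n × E n) : E n :=
  (1 - γ / ρ ^ 2) • v.2 + (γ / ρ ^ 2) • v.1 - (γ * β) • gradient g v.2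

/-- The mean of the Langevin step is `z + γ ∇_z log p(z | x)`. -/
theorem langevinMean_eq {n : ℕ} {g : E n → ℝ} (hg : Differentiable ℝ g) (β ρ γ : ℝ)
    (x z : E n) :
    langevinMean g β ρ γ (x, z) = z + γ • gradient (logCondDensity g β ρ x) z := by
  have h1 : HasFDerivAt g (fderiv ℝ g z) z := (hg z).hasFDerivAt
  have h2 : HasFDerivAt (fun w : E n => x - w) (-ContinuousLinearMap.id ℝ (E n)) z :=
    (hasFDerivAt_id z).const_sub x
  have h3 : HasFDerivAt (logCondDensity g β ρ x) _ z :=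
    ((h1.const_mul β).neg).sub ((h2.norm_sq).const_mul (1 / (2 * ρ ^ 2)))
  have h4 : gradient (logCondDensity g β ρ x) z
      = -(β • gradient g z) + (1 / ρ ^ 2) • (x - z) := by
    refine HasGradientAt.gradient ?_
    rw [hasGradientAt_iff_hasFDerivAt]
    refine h3.congr_fderiv ?_
    ext w
    simp [gradient]
    ring
  rw [h4, langevinMean]
  module

theorem measurable_langevinMean {n : ℕ} (g : E n → ℝ) (β ρ γ : ℝ) :
    Measurable (langevinMean g β ρ γ) := by
  have h : Measurable (gradient g) :=
    (InnerProductSpace.toDual ℝ (E n)).symm.continuous.measurable.comp (measurable_fderiv ℝ g)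
  unfold langevinMean
  fun_prop

/-- The Langevin kernel `(x, z) ↦ 𝒩((1 - γ/ρ²) z + (γ/ρ²) x - γβ ∇g(z), 2γ I)`, the law of
`z + γ ∇_z log p(z | x) + √(2γ) ε` with `ε` standard Gaussian. -/
def zKernel {n : ℕ} (g : E n → ℝ) (β ρ γ : ℝ) : Kernel (E n × E n) (E n) :=
  (gaussianKernel ((2 * γ) • (1 : Matrix (Fin n) (Fin n) ℝ))).comap
    (langevinMean g β ρ γ) (measurable_langevinMean g β ρ γ)

/-! ### The Langevin-within-split-Gibbs kernel -/

/-- One sweep of the sampler from `v = (x, z)`: draw `z'` from the Langevin kernel at `(x, z)`,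
then `x'` from `𝒩(μ(z'), Q⁻¹)`, and return `(x', z')`. -/
def kernel {n d : ℕ} (A : Matrix (Fin d) (Fin n) ℝ) (y : E d) (g : E n → ℝ) (σ β ρ γ : ℝ) :
    Kernel (State n) (State n) :=
  (((xKernel A y σ ρ ×ₖ Kernel.id) ∘ₖ zKernel g β ρ γ).map (WithLp.toLp 2)).comap
    WithLp.ofLp (WithLp.measurable_ofLp 2 (E n × E n))

/-- The constant `C₁ = 1 + ‖ρ⁻² Q⁻¹‖²` (spectral norm). -/
def C1 {n d : ℕ} (A : Matrix (Fin d) (Fin n) ℝ) (σ ρ : ℝ) : ℝ :=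
  1 + ‖(1 / ρ ^ 2) • Matrix.toEuclideanCLM (𝕜 := ℝ) (precision A σ ρ)⁻¹‖ ^ 2

end LwSGS

end

/-! One sweep is an autoregressive step. The Langevin draw adds Gaussian noise to its mean, and the
conditional mean of `x` is affine in `z`. Hence the chain reads `V' = D V + N`, where `D` is the
noise-free sweep and the law of `N` does not depend on `V` (`sweep_apply`). Two copies driven by the
same noise differ only through `D`.

The Langevin mean moves `z` by a gradient step with factor `1 - γ/ρ² - γβm_g` and adds `γ/ρ²` times
`x`. Since `‖ρ⁻²Q⁻¹‖ ≤ 1`, `D` has Lipschitz bound `1 - γβm_g < 1` for the supremum norm on pairs.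
This yields a unique stationary law: existence by a Banach fixed point in `L²` of the noise sequence
(`exists_arStep_eq`), uniqueness by characteristic functions (`eq_of_arStep_eq`). Both transfer to
the Euclidean norm by a linear homeomorphism.

The rate in `W2` comes from the cost `J(v, w)`, the squared distance between the Langevin means. It
contracts by `(1 - γβm_g)²` per synchronous step, is at most the squared Euclidean distance, and
after one step the squared Euclidean distance is at most `C1 * J`. Thus `t` steps give `C1` and `t -
1` contractions (`W2_sq_arStep_iterate_le`). -/

noncomputable section

namespace LwSGS

/-! ### Autoregressive chains with additive noise -/

section Autoregressive

open scoped NNReal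
open Filter Topology

/-! ### The shift on sequences of independent draws -/

section Shift

variable {X : Type*} [MeasurableSpace X]

/-- A sequence of independent draws splits into its tail and its head, which are independent. -/
theorem measurePreserving_tail_head (η : Measure X) [IsProbabilityMeasure η] :
    MeasurePreserving (fun ω : ℕ → X => ((fun k => ω (k + 1)), ω 0))
      (Measure.infinitePi fun _ : ℕ => η) ((Measure.infinitePi fun _ : ℕ => η).prod η) := by
  set P := Measure.infinitePi fun _ : ℕ => η with hP
  let cons : (ℕ → X) × X → ℕ → X := fun p k => Nat.casesOn k p.2 fun j => p.1 j
  have hcons : Measurable cons := by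
    refine measurable_pi_lambda _ fun k => ?_
    cases k with
    | zero => exact measurable_snd
    | succ j => exact (measurable_pi_apply j).comp measurable_fst
  have htail : Measurable (fun ω : ℕ → X => ((fun k => ω (k + 1)), ω 0)) := by fun_prop
  -- Prepending the head inverts the splitting, so the claim reduces to this identity, which is
  -- checked on finite boxes.
  have key : (P.prod η).map cons = P := by
    refine Measure.eq_infinitePi _ fun s t ht => ?_
    classical
    obtain ⟨N, hN⟩ : ∃ N, s ⊆ Finset.range (N + 1) :=
      ⟨s.sup id, fun i hi => Finset.mem_range_succ_iff.2 (Finset.le_sup (f := id) hi)⟩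
    -- Padding with `univ` turns a box over `s` into one over an initial segment, from which
    -- coordinate `0` splits off.
    let t' : ℕ → Set X := fun i => if i ∈ s then t i else Set.univ
    have ht' : ∀ i, MeasurableSet (t' i) := fun i => by
      by_cases h : i ∈ s <;> simp [t', h, ht]
    have hset : cons ⁻¹' (Set.pi s t)
        = (Set.pi (Finset.range N : Finset ℕ) fun j => t' (j + 1)) ×ˢ t' 0 := by
      ext ⟨w, e⟩
      simp only [Set.mem_preimage, Set.mem_pi, Set.mem_prod, Finset.mem_coe, Finset.mem_range]
      constructor
      · intro h
        refine ⟨fun j _ => ?_, ?_⟩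
        · by_cases hj : j + 1 ∈ s
          · simpa [t', hj] using h _ hj
          · simp [t', hj]
        · by_cases hj : 0 ∈ s
          · simpa [t', hj, cons] using h _ hj
          · simp [t', hj]
      · rintro ⟨h1, h2⟩ i hi
        cases i with
        | zero => simpa [t', hi, cons] using h2
        | succ j =>
          have := h1 j (by have := hN hi; simp at this; omega)
          simpa [t', hi] using this
    rw [Measure.map_apply hcons (.pi s.countable_toSet fun i _ => ht i), hset, Measure.prod_prod,
      hP, Measure.infinitePi_pi _ (fun i _ => ht' _), ← Finset.prod_range_succ' (fun i => η (t' i))]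
    rw [← Finset.prod_subset hN (fun i _ hi => by simp [t', hi])]
    exact Finset.prod_congr rfl fun i hi => by simp [t', hi]
  refine ⟨htail, ?_⟩
  conv_lhs => rw [← key]
  rw [Measure.map_map htail hcons]
  exact Measure.map_id

end Shift

/-! ### Synchronous couplings of autoregressive steps -/

variable {X : Type*} [NormedAddCommGroup X] [MeasurableSpace X] [BorelSpace X]
  [SecondCountableTopology X]

/-- The law of `D V + N`, where `V ∼ μ` and `N ∼ η` are independent. -/
def arStep (D : X → X) (η μ : Measure X) : Measure X :=
  (μ.prod η).map fun p => D p.1 + p.2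

/-- The law of `(D V + N, D W + N)`, where `(V, W) ∼ ζ` and `N ∼ η` are independent. -/
def coupStep (D : X → X) (η : Measure X) (ζ : Measure (X × X)) : Measure (X × X) :=
  (ζ.prod η).map fun q => (D q.1.1 + q.2, D q.1.2 + q.2)

theorem isProbabilityMeasure_arStep {D : X → X} (hD : Measurable D) (η μ : Measure X)
    [IsProbabilityMeasure η] [IsProbabilityMeasure μ] : IsProbabilityMeasure (arStep D η μ) :=
  Measure.isProbabilityMeasure_map (by fun_prop)

theorem isProbabilityMeasure_arStep_iterate {D : X → X} (hD : Measurable D) (η μ : Measure X)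
    [IsProbabilityMeasure η] [IsProbabilityMeasure μ] (t : ℕ) :
    IsProbabilityMeasure ((arStep D η)^[t] μ) := by
  induction t with
  | zero => simpa
  | succ t ih =>
    rw [Function.iterate_succ_apply']
    exact isProbabilityMeasure_arStep hD η _

theorem isProbabilityMeasure_coupStep_iterate {D : X → X} (hD : Measurable D) (η : Measure X)
    (ζ : Measure (X × X)) [IsProbabilityMeasure η] [IsProbabilityMeasure ζ] (t : ℕ) :
    IsProbabilityMeasure ((coupStep D η)^[t] ζ) := by
  induction t with
  | zero => simpa
  | succ t ih =>
    rw [Function.iterate_succ_apply']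
    exact Measure.isProbabilityMeasure_map (by fun_prop)

theorem fst_coupStep {D : X → X} (hD : Measurable D) (η : Measure X) [SFinite η]
    (ζ : Measure (X × X)) [SFinite ζ] : (coupStep D η ζ).fst = arStep D η ζ.fst := by
  have h : ζ.fst.prod η = (ζ.prod η).map (Prod.map Prod.fst id) := by
    rw [← Measure.map_prod_map _ _ measurable_fst measurable_id, Measure.map_id, Measure.fst]
  rw [coupStep, Measure.fst_map_prodMk (by fun_prop), arStep, h,
    Measure.map_map (by fun_prop) (by fun_prop)]
  rfl

theorem snd_coupStep {D : X → X} (hD : Measurable D) (η : Measure X) [SFinite η]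
    (ζ : Measure (X × X)) [SFinite ζ] : (coupStep D η ζ).snd = arStep D η ζ.snd := by
  have h : ζ.snd.prod η = (ζ.prod η).map (Prod.map Prod.snd id) := by
    rw [← Measure.map_prod_map _ _ measurable_snd measurable_id, Measure.map_id, Measure.snd]
  rw [coupStep, Measure.snd_map_prodMk (by fun_prop), arStep, h,
    Measure.map_map (by fun_prop) (by fun_prop)]
  rfl

theorem coupStep_iterate_mem_transportPlans {D : X → X} (hD : Measurable D) (η : Measure X)
    [IsProbabilityMeasure η] {μ ν : Measure X} {ζ : Measure (X × X)} [IsProbabilityMeasure ζ]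
    (hζ : ζ ∈ transportPlans μ ν) (t : ℕ) :
    (coupStep D η)^[t] ζ ∈ transportPlans ((arStep D η)^[t] μ) ((arStep D η)^[t] ν) := by
  induction t with
  | zero => exact hζ
  | succ t ih =>
    have := isProbabilityMeasure_coupStep_iterate hD η ζ t
    simp only [Function.iterate_succ_apply']
    exact ⟨by rw [fst_coupStep hD, ih.1], by rw [snd_coupStep hD, ih.2]⟩

theorem lintegral_coupStep {D : X → X} (hD : Measurable D) (η : Measure X) [SFinite η]
    (ζ : Measure (X × X)) [SFinite ζ] {f : X × X → ℝ≥0∞} (hf : Measurable f) :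
    ∫⁻ p, f p ∂coupStep D η ζ = ∫⁻ p, ∫⁻ e, f (D p.1 + e, D p.2 + e) ∂η ∂ζ := by
  rw [coupStep, lintegral_map hf (by fun_prop), lintegral_prod _ (by fun_prop)]

/-- A family of costs that decreases along every synchronous step decreases in mean. -/
theorem lintegral_coupStep_iterate_le {D : X → X} (hD : Measurable D) (η : Measure X)
    [IsProbabilityMeasure η] (ζ : Measure (X × X)) [IsProbabilityMeasure ζ]
    {J : ℕ → X × X → ℝ≥0∞} (hJ : ∀ s, Measurable (J s))
    (hstep : ∀ s v w e, J s (D v + e, D w + e) ≤ J (s + 1) (v, w)) (t s : ℕ) :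
    ∫⁻ p, J s p ∂((coupStep D η)^[t] ζ) ≤ ∫⁻ p, J (s + t) p ∂ζ := by
  induction t generalizing s with
  | zero => simp
  | succ t ih =>
    have := isProbabilityMeasure_coupStep_iterate hD η ζ t
    rw [Function.iterate_succ_apply', lintegral_coupStep hD _ _ (hJ s)]
    calc ∫⁻ p, ∫⁻ e, J s (D p.1 + e, D p.2 + e) ∂η ∂((coupStep D η)^[t] ζ)
        ≤ ∫⁻ p, ∫⁻ _, J (s + 1) p ∂η ∂((coupStep D η)^[t] ζ) :=
          lintegral_mono fun p => lintegral_mono fun e => hstep s p.1 p.2 e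
      _ = ∫⁻ p, J (s + 1) p ∂((coupStep D η)^[t] ζ) := by simp
      _ ≤ ∫⁻ p, J (s + 1 + t) p ∂ζ := ih (s + 1)
      _ = ∫⁻ p, J (s + (t + 1)) p ∂ζ := by rw [add_right_comm, add_assoc]

theorem W2_sq {Y : Type*} [PseudoEMetricSpace Y] [MeasurableSpace Y] (μ ν : Measure Y) :
    W2 μ ν ^ 2 = ⨅ ζ ∈ transportPlans μ ν, ∫⁻ p, edist p.1 p.2 ^ 2 ∂ζ := by
  rw [W2, ← ENNReal.rpow_natCast, ← ENNReal.rpow_mul]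
  norm_num

/-- Synchronous coupling bound: if a cost `J` contracts by the factor `c` along synchronous steps
and controls the squared distance after one step, then so does the Wasserstein distance. -/
theorem W2_sq_arStep_iterate_le {D : X → X} (hD : Measurable D) (η μ ν : Measure X)
    [IsProbabilityMeasure η] [IsProbabilityMeasure μ] [IsProbabilityMeasure ν]
    {J : X × X → ℝ≥0∞} (hJ : Measurable J)
    {c C : ℝ≥0∞} (hc : c ≠ ∞) (hC : C ≠ ∞)
    (hstep : ∀ v w e, J (D v + e, D w + e) ≤ c * J (v, w))
    (hJle : ∀ v w, J (v, w) ≤ edist v w ^ 2)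
    (hleJ : ∀ v w, edist (D v) (D w) ^ 2 ≤ C * J (v, w)) (t : ℕ) :
    W2 ((arStep D η)^[t + 1] μ) ((arStep D η)^[t + 1] ν) ^ 2 ≤ C * c ^ t * W2 μ ν ^ 2 := by
  have key : ∀ ζ ∈ transportPlans μ ν,
      W2 ((arStep D η)^[t + 1] μ) ((arStep D η)^[t + 1] ν) ^ 2
        ≤ C * c ^ t * ∫⁻ p, edist p.1 p.2 ^ 2 ∂ζ := by
    intro ζ hζ
    have : IsProbabilityMeasure ζ := ⟨by rw [← Measure.fst_univ, hζ.1, measure_univ]⟩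
    have := isProbabilityMeasure_coupStep_iterate hD η ζ t
    -- The weights `c ^ s` turn contraction of `J` into a decreasing family of costs.
    have hs : ∀ s v w e, (fun s p => c ^ s * J p) s (D v + e, D w + e)
        ≤ (fun s p => c ^ s * J p) (s + 1) (v, w) := fun s v w e => by
      simp only [pow_succ, mul_assoc]
      gcongr
      exact hstep v w e
    have hiter := lintegral_coupStep_iterate_le hD η ζ (J := fun s p => c ^ s * J p)
      (fun s => by fun_prop) hs t 0
    simp only [pow_zero, one_mul, zero_add] at hiter
    rw [W2_sq]
    -- The last of the `t + 1` steps is spent on `hleJ`, its noise cancelling in the distance; the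
    -- other `t` contract `J`.
    calc _ ≤ ∫⁻ p, edist p.1 p.2 ^ 2 ∂((coupStep D η)^[t + 1] ζ) :=
          iInf₂_le _ (coupStep_iterate_mem_transportPlans hD η hζ (t + 1))
      _ = ∫⁻ p, edist (D p.1) (D p.2) ^ 2 ∂((coupStep D η)^[t] ζ) := by
          rw [Function.iterate_succ_apply', lintegral_coupStep hD _ _ (by fun_prop)]
          simp
      _ ≤ ∫⁻ p, C * J p ∂((coupStep D η)^[t] ζ) := lintegral_mono fun p => hleJ p.1 p.2
      _ = C * ∫⁻ p, J p ∂((coupStep D η)^[t] ζ) := lintegral_const_mul _ hJ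
      _ ≤ C * ∫⁻ p, c ^ t * J p ∂ζ := by gcongr
      _ = C * c ^ t * ∫⁻ p, J p ∂ζ := by rw [lintegral_const_mul _ hJ, mul_assoc]
      _ ≤ C * c ^ t * ∫⁻ p, edist p.1 p.2 ^ 2 ∂ζ := by
          gcongr with p
          exact hJle p.1 p.2
  have hprod : μ.prod ν ∈ transportPlans μ ν := ⟨Measure.fst_prod, Measure.snd_prod⟩
  -- A zero constant cannot be pulled out of the infimum in `ℝ≥0∞`; there the product coupling
  -- already gives distance zero.
  rcases eq_or_ne (C * c ^ t) 0 with h0 | h0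
  · simpa [h0] using key _ hprod
  · rw [W2_sq μ ν, ENNReal.mul_iInf_of_ne h0
      (ENNReal.mul_ne_top hC (ENNReal.pow_ne_top hc))]
    refine le_iInf fun ζ => ?_
    by_cases hζ : ζ ∈ transportPlans μ ν
    · simpa [hζ] using key ζ hζ
    · simp [hζ, ENNReal.mul_top h0]

/-! ### Existence and uniqueness of the stationary law -/

theorem memLp_comp_of_lipschitz {Ω Y : Type*} [MeasurableSpace Ω] {P : Measure Ω}
    [IsFiniteMeasure P] [NormedAddCommGroup Y] {K : ℝ≥0} {D : Y → Y} (hD : LipschitzWith K D)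
    {f : Ω → Y} {p : ℝ≥0∞} (hf : MemLp f p P) : MemLp (fun ω => D (f ω)) p P := by
  have h1 : LipschitzWith K fun x => D x - D 0 := fun x y => by simpa using hD x y
  convert! (h1.comp_memLp (by simp) hf).add (memLp_const (D 0)) using 1
  ext ω
  simp

/-- A contraction with additive square-integrable noise has a square-integrable stationary law,
obtained as a Banach fixed point among square-integrable functions of the noise sequence. -/
theorem exists_arStep_eq [CompleteSpace X] {K : ℝ≥0} (hK : K < 1) {D : X → X}
    (hD : LipschitzWith K D) (η : Measure X) [IsProbabilityMeasure η] (hη : MemLp id 2 η) :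
    ∃ ν : Measure X, IsProbabilityMeasure ν ∧ MemLp id 2 ν ∧ arStep D η ν = ν := by
  let P := Measure.infinitePi fun _ : ℕ => η
  have hDm : Measurable D := hD.continuous.measurable
  have hth := measurePreserving_tail_head η
  let θ : (ℕ → X) → ℕ → X := fun ω k => ω (k + 1)
  have hθ : MeasurePreserving θ P P := measurePreserving_fst.comp hth
  have h0 : MeasurePreserving (fun ω : ℕ → X => ω 0) P η := measurePreserving_snd.comp hth
  have hmem : ∀ Z : Lp X 2 P, MemLp (fun ω => D (Z (θ ω)) + ω 0) 2 P := by
    intro Z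
    exact (memLp_comp_of_lipschitz hD ((Lp.memLp Z).comp_measurePreserving hθ)).add
      (hη.comp_measurePreserving h0)
  -- A fixed point satisfies `Z(ω) = D(Z(θω)) + ω₀`. In a difference `ω₀` cancels, and `θ` preserves
  -- `L²` norms, so `Φ` inherits the constant `K`.
  let Φ : Lp X 2 P → Lp X 2 P := fun Z => (hmem Z).toLp _
  have hΦ : ContractingWith K Φ := by
    refine ⟨hK, fun Z Z' => ?_⟩
    rw [Lp.edist_toLp_toLp, Lp.edist_def, ← eLpNorm_comp_measurePreserving
      ((Lp.aestronglyMeasurable Z).sub (Lp.aestronglyMeasurable Z')) hθ]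
    refine eLpNorm_le_nnreal_smul_eLpNorm_of_ae_le_mul (ae_of_all _ fun ω => ?_) 2
    have := hD.nndist_le (Z (θ ω)) (Z' (θ ω))
    simpa [nndist_eq_nnnorm] using this
  let Z := hΦ.fixedPoint Φ
  have hZ : Z =ᵐ[P] fun ω => D (Z (θ ω)) + ω 0 := by
    have h : Φ Z = Z := hΦ.fixedPoint_isFixedPt
    have h' := (hmem Z).coeFn_toLp
    change (Φ Z : (ℕ → X) → X) =ᵐ[P] _ at h'
    rwa [h] at h'
  have hZm : Measurable Z := (Lp.stronglyMeasurable Z).measurable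
  refine ⟨P.map Z, Measure.isProbabilityMeasure_map hZm.aemeasurable, ?_, ?_⟩
  · exact (memLp_map_measure_iff aestronglyMeasurable_id hZm.aemeasurable).2 (Lp.memLp Z)
  -- The tail is independent of `ω₀` and has law `P`, so the fixed-point equation says that the law
  -- of `Z` is stationary.
  · have h : (P.map Z).prod η = (P.prod η).map (Prod.map Z id) := by
      rw [← Measure.map_prod_map _ _ hZm measurable_id, Measure.map_id]
    rw [arStep, h, Measure.map_map (by fun_prop) (by fun_prop), ← hth.map_eq,
      Measure.map_map (by fun_prop) hth.measurable]
    exact (Measure.map_congr hZ).symm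

/-- A contraction with additive noise has at most one stationary law. -/
theorem eq_of_arStep_eq [CompleteSpace X] [NormedSpace ℝ X] {K : ℝ≥0} (hK : K < 1) {D : X → X}
    (hD : LipschitzWith K D) (η : Measure X) [IsProbabilityMeasure η] {μ ν : Measure X}
    [IsProbabilityMeasure μ] [IsProbabilityMeasure ν] (hμ : arStep D η μ = μ)
    (hν : arStep D η ν = ν) : μ = ν := by
  have hDm : Measurable D := hD.continuous.measurable
  refine Measure.ext_of_charFunDual (funext fun L => ?_)
  let e : X → ℂ := fun v => Complex.exp (L v * Complex.I)
  have he : Continuous e := by fun_prop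
  have he1 : ∀ v, ‖e v‖ = 1 := fun v => Complex.norm_exp_ofReal_mul_I _
  have heL : ∀ v w, ‖e v - e w‖ₑ ≤ ‖L‖ₑ * edist v w := by
    intro v w
    have h1 : e v - e w = e w * (Complex.exp (Complex.I * ((L (v - w) : ℝ) : ℂ)) - 1) := by
      simp only [e, mul_sub, ← Complex.exp_add, mul_one]
      congr 2
      push_cast [map_sub]
      ring
    rw [h1, enorm_mul, ← ofReal_norm (e w), he1, ENNReal.ofReal_one, one_mul,
      edist_eq_enorm_sub]
    exact Real.enorm_exp_I_mul_ofReal_sub_one_le.trans (L.le_opENorm _)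
  have he2 : ∀ v w, ‖e v - e w‖ₑ ≤ 2 := by
    intro v w
    refine (enorm_sub_le).trans ?_
    rw [← ofReal_norm, ← ofReal_norm, he1, he1]
    norm_num
  -- No moments of `μ` and `ν` are assumed; truncation at `2`, the trivial bound on `‖e v - e w‖ₑ`,
  -- permits dominated convergence.
  let J : ℕ → X × X → ℝ≥0∞ := fun s p => min 2 (‖L‖ₑ * (K ^ s * edist p.1 p.2))
  have hJ : ∀ s, Measurable (J s) := fun s => by fun_prop
  have hstep : ∀ s v w x, J s (D v + x, D w + x) ≤ J (s + 1) (v, w) := by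
    intro s v w x
    refine min_le_min le_rfl ?_
    rw [pow_succ, mul_assoc, edist_add_right]
    gcongr
    exact hD v w
  have hbound : ∀ t, ‖charFunDual μ L - charFunDual ν L‖ₑ ≤ ∫⁻ p, J t p ∂(μ.prod ν) := by
    intro t
    let ζ := (coupStep D η)^[t] (μ.prod ν)
    have : IsProbabilityMeasure ζ := isProbabilityMeasure_coupStep_iterate hDm η _ t
    -- By stationarity the iterated coupling keeps the marginals `μ` and `ν`.
    have hζ : ζ ∈ transportPlans μ ν := by
      have := coupStep_iterate_mem_transportPlans hDm η (μ := μ) (ν := ν) (ζ := μ.prod ν)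
        ⟨Measure.fst_prod, Measure.snd_prod⟩ t
      rwa [Function.iterate_fixed hμ, Function.iterate_fixed hν] at this
    have h1 : charFunDual μ L = ∫ p, e p.1 ∂ζ := by
      rw [charFunDual_apply, ← hζ.1, Measure.fst, integral_map (by fun_prop) (by fun_prop)]
    have h2 : charFunDual ν L = ∫ p, e p.2 ∂ζ := by
      rw [charFunDual_apply, ← hζ.2, Measure.snd, integral_map (by fun_prop) (by fun_prop)]
    have hi : ∀ f : X × X → X, Continuous f → Integrable (fun p => e (f p)) ζ := fun f hf =>
      Integrable.of_bound (by fun_prop) 1 (ae_of_all _ fun p => (he1 _).le)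
    rw [h1, h2, ← integral_sub (hi _ continuous_fst) (hi _ continuous_snd)]
    calc _ ≤ ∫⁻ p, ‖e p.1 - e p.2‖ₑ ∂ζ := enorm_integral_le_lintegral_enorm _
      _ ≤ ∫⁻ p, J 0 p ∂ζ := lintegral_mono fun p => by
          simpa [J] using ⟨he2 p.1 p.2, heL p.1 p.2⟩
      _ ≤ ∫⁻ p, J (0 + t) p ∂(μ.prod ν) := lintegral_coupStep_iterate_le hDm η _ hJ hstep t 0
      _ = _ := by rw [zero_add]
  have hlim : Tendsto (fun t => ∫⁻ p, J t p ∂(μ.prod ν)) atTop (𝓝 (∫⁻ _, 0 ∂(μ.prod ν))) := by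
    refine tendsto_lintegral_of_dominated_convergence (fun _ => 2) hJ
      (fun t => ae_of_all _ fun p => min_le_left _ _) (by simp) (ae_of_all _ fun p => ?_)
    have hp : Tendsto (fun t : ℕ => (K : ℝ≥0∞) ^ t) atTop (𝓝 0) :=
      ENNReal.tendsto_pow_atTop_nhds_zero_of_lt_one (by exact_mod_cast hK)
    have h1 : Tendsto (fun t : ℕ => ‖L‖ₑ * ((K : ℝ≥0∞) ^ t * edist p.1 p.2)) atTop (𝓝 0) := by
      have := ENNReal.Tendsto.const_mul (a := ‖L‖ₑ)
        (ENNReal.Tendsto.mul_const hp (.inr (edist_ne_top p.1 p.2))) (.inr enorm_ne_top)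
      simpa using this
    exact tendsto_of_tendsto_of_tendsto_of_le_of_le tendsto_const_nhds h1
      (fun _ => zero_le) (fun _ => min_le_right _ _)
  have h0 := ge_of_tendsto' hlim hbound
  rw [lintegral_zero, nonpos_iff_eq_zero, enorm_eq_zero, sub_eq_zero] at h0
  exact h0

theorem memLp_id_arStep {K : ℝ≥0} {D : X → X} (hD : LipschitzWith K D) (η μ : Measure X)
    [IsProbabilityMeasure η] [IsProbabilityMeasure μ] (hη : MemLp id 2 η) (hμ : MemLp id 2 μ) :
    MemLp id 2 (arStep D η μ) := by
  have hDm : Measurable D := hD.continuous.measurable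
  refine (memLp_map_measure_iff aestronglyMeasurable_id (by fun_prop)).2 ?_
  exact (memLp_comp_of_lipschitz hD (hμ.comp_measurePreserving measurePreserving_fst)).add
    (hη.comp_measurePreserving measurePreserving_snd)

theorem memLp_id_arStep_iterate {K : ℝ≥0} {D : X → X} (hD : LipschitzWith K D) (η μ : Measure X)
    [IsProbabilityMeasure η] [IsProbabilityMeasure μ] (hη : MemLp id 2 η) (hμ : MemLp id 2 μ)
    (t : ℕ) : MemLp id 2 ((arStep D η)^[t] μ) := by
  induction t with
  | zero => exact hμ
  | succ t ih =>
    have := isProbabilityMeasure_arStep_iterate hD.continuous.measurable η μ t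
    rw [Function.iterate_succ_apply']
    exact memLp_id_arStep hD η _ hη ih

/-- A kernel that draws from a translate of a fixed law acts on measures as `arStep`. -/
theorem comp_eq_arStep {κ : Kernel X X} {D : X → X} (hD : Measurable D) {η : Measure X}
    [SFinite η] (hκ : ∀ v, κ v = η.map fun e => D v + e) (μ : Measure X) [SFinite μ] :
    κ ∘ₘ μ = arStep D η μ := by
  ext s hs
  have hm : Measurable fun p : X × X => D p.1 + p.2 := by fun_prop
  rw [Measure.bind_apply hs κ.aemeasurable, arStep, Measure.map_apply hm hs,
    Measure.prod_apply (hm hs)]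
  refine lintegral_congr fun v => ?_
  rw [hκ, Measure.map_apply (by fun_prop) hs]
  rfl

theorem pow_comp_eq_arStep_iterate {κ : Kernel X X} {D : X → X} (hD : Measurable D)
    {η : Measure X} [IsProbabilityMeasure η] (hκ : ∀ v, κ v = η.map fun e => D v + e)
    (μ : Measure X) [IsProbabilityMeasure μ] (t : ℕ) :
    (κ ^ t) ∘ₘ μ = (arStep D η)^[t] μ := by
  induction t with
  | zero => exact Measure.id_comp
  | succ t ih =>
    have := isProbabilityMeasure_arStep_iterate hD η μ t
    rw [pow_succ', Function.iterate_succ_apply', ← ih]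
    rw [← ih] at this
    rw [← comp_eq_arStep hD hκ]
    exact Measure.comp_assoc.symm

/-- `arStep` is equivariant under continuous linear equivalences. -/
theorem arStep_map {Y : Type*} [NormedAddCommGroup Y] [MeasurableSpace Y] [BorelSpace Y]
    [SecondCountableTopology Y] [NormedSpace ℝ X] [NormedSpace ℝ Y] (e : X ≃L[ℝ] Y) {D : X → X}
    (hD : Measurable D) (η μ : Measure X) [SFinite η] [SFinite μ] :
    arStep (fun v => e (D (e.symm v))) (η.map e) (μ.map e) = (arStep D η μ).map e := by
  have he : Measurable e := e.continuous.measurable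
  have he' : Measurable e.symm := e.symm.continuous.measurable
  rw [arStep, arStep, Measure.map_prod_map _ _ he he, Measure.map_map (by fun_prop) (by fun_prop),
    Measure.map_map he (by fun_prop)]
  congr 1
  ext p
  simp

end Autoregressive

/-! ### The exact step -/

section ExactStep

variable {n d : ℕ}

/-- The linear part `ρ⁻² Q⁻¹` of the conditional mean. -/
def condMeanCLM (A : Matrix (Fin d) (Fin n) ℝ) (σ ρ : ℝ) : E n →L[ℝ] E n :=
  (1 / ρ ^ 2) • Matrix.toEuclideanCLM (𝕜 := ℝ) (precision A σ ρ)⁻¹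

theorem condMean_add (A : Matrix (Fin d) (Fin n) ℝ) (y : E d) (σ ρ : ℝ) (z w : E n) :
    condMean A y σ ρ (z + w) = condMean A y σ ρ z + condMeanCLM A σ ρ w := by
  simp only [condMean, condMeanCLM, smul_add, map_add, map_smul, add_assoc]
  rfl

theorem condMean_sub (A : Matrix (Fin d) (Fin n) ℝ) (y : E d) (σ ρ : ℝ) (z w : E n) :
    condMean A y σ ρ z - condMean A y σ ρ w = condMeanCLM A σ ρ (z - w) := by
  conv_lhs => rw [← add_sub_cancel w z, condMean_add]
  abel

theorem precision_posDef (A : Matrix (Fin d) (Fin n) ℝ) (σ : ℝ) {ρ : ℝ} (hρ : 0 < ρ) :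
    (precision A σ ρ).PosDef := by
  refine Matrix.PosDef.posSemidef_add ?_ (Matrix.PosDef.one.smul (by positivity))
  have h : (A.transpose * A).PosSemidef := by
    simpa using Matrix.posSemidef_conjTranspose_mul_self A
  exact h.smul (by positivity)

theorem toEuclideanCLM_precision (A : Matrix (Fin d) (Fin n) ℝ) (σ ρ : ℝ) (w : E n) :
    Matrix.toEuclideanCLM (𝕜 := ℝ) (precision A σ ρ) w
      = (1 / σ ^ 2) • Matrix.toEuclideanCLM (𝕜 := ℝ) (A.transpose * A) w
        + (1 / ρ ^ 2) • w := by
  simp [precision, map_add, map_smul]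

/-- Because `Q ⪰ ρ⁻² I`, the vector `w = Q⁻¹u` satisfies `ρ⁻²‖w‖² ≤ ⟪Qw, w⟫ = ⟪u, w⟫ ≤ ‖u‖‖w‖`. -/
theorem norm_condMeanCLM_le (A : Matrix (Fin d) (Fin n) ℝ) (σ : ℝ) {ρ : ℝ} (hρ : 0 < ρ) :
    ‖condMeanCLM A σ ρ‖ ≤ 1 := by
  refine ContinuousLinearMap.opNorm_le_bound _ zero_le_one fun u => ?_
  rw [one_mul]
  obtain ⟨w, hwu⟩ : ∃ w, w = Matrix.toEuclideanCLM (𝕜 := ℝ) (precision A σ ρ)⁻¹ u := ⟨_, rfl⟩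
  have hdet : IsUnit (precision A σ ρ).det :=
    (Matrix.isUnit_iff_isUnit_det _).1 (precision_posDef A σ hρ).isUnit
  have hw : Matrix.toEuclideanCLM (𝕜 := ℝ) (precision A σ ρ) w = u := by
    rw [hwu, ← mul_apply_eq_comp, ← map_mul, Matrix.mul_nonsing_inv _ hdet, map_one]
    rfl
  have hA : 0 ≤ ⟪Matrix.toEuclideanCLM (𝕜 := ℝ) (A.transpose * A) w, w⟫ := by
    have h := (Matrix.posSemidef_conjTranspose_mul_self A).dotProduct_mulVec_nonneg w.ofLp
    rw [real_inner_comm]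
    simpa [EuclideanSpace.inner_eq_star_dotProduct, dotProduct_comm] using h
  have h1 : 1 / ρ ^ 2 * ‖w‖ ^ 2 ≤ ‖u‖ * ‖w‖ := by
    refine le_trans ?_ (real_inner_le_norm u w)
    conv_rhs => rw [← hw]
    rw [toEuclideanCLM_precision, inner_add_left, real_inner_smul_left, real_inner_smul_left,
      real_inner_self_eq_norm_sq]
    have : 0 ≤ 1 / σ ^ 2 := by positivity
    linarith [mul_nonneg this hA]
  have h2 : ‖condMeanCLM A σ ρ u‖ = 1 / ρ ^ 2 * ‖w‖ := by
    rw [condMeanCLM, smul_apply, ← hwu, norm_smul, Real.norm_of_nonneg (by positivity)]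
  rw [h2]
  rcases (norm_nonneg w).eq_or_lt with h0 | h0
  · rw [← h0]
    simp
  · refine le_of_mul_le_mul_right ?_ h0
    linarith [h1, sq ‖w‖, mul_assoc (1 / ρ ^ 2) ‖w‖ ‖w‖]

end ExactStep

/-! ### The Langevin step -/

section LangevinStep

variable {n : ℕ} {g : E n → ℝ}

theorem hasFDerivAt_gradient (hg : ContDiff ℝ 2 g) (z : E n) :
    HasFDerivAt (gradient g) (hessian g z) z := by
  have h1 : Differentiable ℝ (fderiv ℝ g) :=
    (hg.fderiv_right (m := 1) (by norm_num)).differentiable (by norm_num)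
  have h2 : Differentiable ℝ (gradient g) := fun w =>
    ((InnerProductSpace.toDual ℝ (E n)).symm.toContinuousLinearEquiv.differentiableAt).comp w (h1 w)
  exact (h2 z).hasFDerivAt

/-- Links the Hessian to the second derivative, whose symmetry makes the Hessian self-adjoint. -/
theorem inner_hessian (hg : ContDiff ℝ 2 g) (z u w : E n) :
    ⟪hessian g z u, w⟫ = fderiv ℝ (fderiv ℝ g) z u w := by
  have h1 : Differentiable ℝ (fderiv ℝ g) :=
    (hg.fderiv_right (m := 1) (by norm_num)).differentiable (by norm_num)
  have h2 : HasFDerivAt (fun y => ⟪gradient g y, w⟫)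
      ((innerSL ℝ w).comp (hessian g z)) z := by
    refine ((innerSL ℝ w).hasFDerivAt.comp z (hasFDerivAt_gradient hg z)).congr_of_eventuallyEq
      (Filter.Eventually.of_forall fun y => ?_)
    simp
  have h3 : HasFDerivAt (fun y => ⟪gradient g y, w⟫)
      ((ContinuousLinearMap.apply ℝ ℝ w).comp (fderiv ℝ (fderiv ℝ g) z)) z := by
    refine ((ContinuousLinearMap.apply ℝ ℝ w).hasFDerivAt.comp z
      (h1 z).hasFDerivAt).congr_of_eventuallyEq (Filter.Eventually.of_forall fun y => ?_)
    simp [gradient]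
  have h4 := DFunLike.congr_fun (h2.unique h3) u
  simpa [real_inner_comm] using h4

theorem inner_hessian_comm (hg : ContDiff ℝ 2 g) (z u w : E n) :
    ⟪hessian g z u, w⟫ = ⟪u, hessian g z w⟫ := by
  rw [real_inner_comm (hessian g z w) u, inner_hessian hg, inner_hessian hg]
  exact (hg.contDiffAt.isSymmSndFDerivAt (by simp)) u w

theorem norm_le_of_isSymmetric_of_inner_le {V : Type*} [NormedAddCommGroup V]
    [InnerProductSpace ℝ V] {T : V →L[ℝ] V} (hT : (T : V →ₗ[ℝ] V).IsSymmetric) {c : ℝ}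
    (hc : 0 ≤ c) (h0 : ∀ w, 0 ≤ ⟪T w, w⟫) (h1 : ∀ w, ⟪T w, w⟫ ≤ c * ‖w‖ ^ 2) : ‖T‖ ≤ c := by
  rw [T.norm_eq_iSup_rayleighQuotient hT]
  refine ciSup_le fun w => ?_
  rw [ContinuousLinearMap.rayleighQuotient, ContinuousLinearMap.reApplyInnerSelf_apply]
  simp only [RCLike.re_to_real]
  rw [abs_of_nonneg (div_nonneg (h0 w) (by positivity))]
  exact div_le_of_le_mul₀ (by positivity) hc (h1 w)

variable {β ρ γ M_g m_g : ℝ}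

/-- A gradient step with small step size is a contraction. -/
theorem norm_gradient_step_sub_le (hβ : 0 < β) (hρ : 0 < ρ) (hγ : 0 < γ) (hM : 0 < M_g)
    (hg : ContDiff ℝ 2 g) (hgM : ∀ z, ‖hessian g z‖ ≤ M_g)
    (hgm : ∀ z w, m_g * ‖w‖ ^ 2 ≤ ⟪hessian g z w, w⟫)
    (hγle : γ ≤ (β * M_g + 1 / ρ ^ 2)⁻¹) (z w : E n) :
    ‖((1 - γ / ρ ^ 2) • z - (γ * β) • gradient g z)
        - ((1 - γ / ρ ^ 2) • w - (γ * β) • gradient g w)‖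
      ≤ (1 - γ / ρ ^ 2 - γ * β * m_g) * ‖z - w‖ := by
  -- For `n = 0` the Hessian bounds do not force `m_g ≤ M_g`, and the factor may be negative.
  rcases subsingleton_or_nontrivial (E n) with hn | hn
  · simp [Subsingleton.elim z w]
  have hγ1 : γ * β * M_g + γ / ρ ^ 2 ≤ 1 := by
    have h := mul_le_mul_of_nonneg_right hγle (by positivity : 0 ≤ β * M_g + 1 / ρ ^ 2)
    rw [inv_mul_cancel₀ (by positivity)] at h
    calc _ = γ * (β * M_g + 1 / ρ ^ 2) := by ring
      _ ≤ 1 := h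
  have hup : ∀ z w, ⟪hessian g z w, w⟫ ≤ M_g * ‖w‖ ^ 2 := fun z w =>
    calc _ ≤ ‖hessian g z w‖ * ‖w‖ := real_inner_le_norm _ _
      _ ≤ M_g * ‖w‖ * ‖w‖ := by gcongr; exact (hessian g z).le_of_opNorm_le (hgM z) w
      _ = _ := by ring
  have hγβ : 0 < γ * β := mul_pos hγ hβ
  have hmM : m_g ≤ M_g := by
    obtain ⟨u, hu⟩ := exists_ne (0 : E n)
    have := (hgm 0 u).trans (hup 0 u)
    exact le_of_mul_le_mul_right this (by positivity)
  have hc : 0 ≤ 1 - γ / ρ ^ 2 - γ * β * m_g := by nlinarith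
  let T : E n → E n →L[ℝ] E n := fun y =>
    (1 - γ / ρ ^ 2) • ContinuousLinearMap.id ℝ (E n) - (γ * β) • hessian g y
  have hT : ∀ y, HasFDerivAt (fun z => (1 - γ / ρ ^ 2) • z - (γ * β) • gradient g z) (T y) y :=
    fun y => ((hasFDerivAt_id y).fun_const_smul _).fun_sub
      ((hasFDerivAt_gradient hg y).fun_const_smul _)
  have hTi : ∀ y u v, ⟪T y u, v⟫ = (1 - γ / ρ ^ 2) * ⟪u, v⟫ - γ * β * ⟪hessian g y u, v⟫ := by
    intro y u v
    simp [T, inner_sub_left, real_inner_smul_left]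
  -- The derivative `T y` is symmetric. The step-size condition makes it positive semidefinite, so
  -- its norm is its largest Rayleigh quotient, bounded through `m_g`.
  have hTn : ∀ y, ‖T y‖ ≤ 1 - γ / ρ ^ 2 - γ * β * m_g := by
    intro y
    refine norm_le_of_isSymmetric_of_inner_le (fun u v => ?_) hc (fun u => ?_) fun u => ?_
    · change ⟪T y u, v⟫ = ⟪u, T y v⟫
      rw [real_inner_comm (T y v), hTi, hTi, inner_hessian_comm hg, real_inner_comm u v,
        real_inner_comm u]
    · rw [hTi, real_inner_self_eq_norm_sq]
      have h1 := mul_le_mul_of_nonneg_left (hup y u) hγβ.le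
      have h2 := mul_le_mul_of_nonneg_right hγ1 (sq_nonneg ‖u‖)
      linarith
    · rw [hTi, real_inner_self_eq_norm_sq]
      have h1 := mul_le_mul_of_nonneg_left (hgm y u) hγβ.le
      linarith
  exact convex_univ.norm_image_sub_le_of_norm_hasFDerivWithin_le
    (fun y _ => (hT y).hasFDerivWithinAt) (fun y _ => hTn y) (Set.mem_univ w) (Set.mem_univ z)

theorem norm_langevinMean_sub_le (hβ : 0 < β) (hρ : 0 < ρ) (hγ : 0 < γ) (hM : 0 < M_g)
    (hg : ContDiff ℝ 2 g) (hgM : ∀ z, ‖hessian g z‖ ≤ M_g)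
    (hgm : ∀ z w, m_g * ‖w‖ ^ 2 ≤ ⟪hessian g z w, w⟫)
    (hγle : γ ≤ (β * M_g + 1 / ρ ^ 2)⁻¹) (v w : E n × E n) :
    ‖langevinMean g β ρ γ v - langevinMean g β ρ γ w‖
      ≤ (1 - γ / ρ ^ 2 - γ * β * m_g) * ‖v.2 - w.2‖ + γ / ρ ^ 2 * ‖v.1 - w.1‖ := by
  have h : langevinMean g β ρ γ v - langevinMean g β ρ γ w
      = (((1 - γ / ρ ^ 2) • v.2 - (γ * β) • gradient g v.2)
        - ((1 - γ / ρ ^ 2) • w.2 - (γ * β) • gradient g w.2))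
        + (γ / ρ ^ 2) • (v.1 - w.1) := by
    simp only [langevinMean]
    module
  rw [h]
  refine (norm_add_le _ _).trans (add_le_add
    (norm_gradient_step_sub_le hβ hρ hγ hM hg hgM hgm hγle _ _) ?_)
  rw [norm_smul, Real.norm_of_nonneg (by positivity)]

theorem div_sq_le_one (hβ : 0 < β) (hρ : 0 < ρ) (hM : 0 < M_g)
    (hγle : γ ≤ (β * M_g + 1 / ρ ^ 2)⁻¹) : γ / ρ ^ 2 ≤ 1 := by
  have h := mul_le_mul_of_nonneg_right hγle (by positivity : 0 ≤ 1 / ρ ^ 2)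
  calc γ / ρ ^ 2 = γ * (1 / ρ ^ 2) := by ring
    _ ≤ (β * M_g + 1 / ρ ^ 2)⁻¹ * (1 / ρ ^ 2) := h
    _ ≤ (β * M_g + 1 / ρ ^ 2)⁻¹ * (β * M_g + 1 / ρ ^ 2) := by
        gcongr
        linarith [mul_pos hβ hM]
    _ = 1 := inv_mul_cancel₀ (by positivity)

end LangevinStep

/-! ### One sweep as an autoregressive step -/

section Sweep

variable {n d : ℕ}

/-- The noise-free sweep. -/
def sweepMean (A : Matrix (Fin d) (Fin n) ℝ) (y : E d) (g : E n → ℝ) (σ β ρ γ : ℝ)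
    (v : E n × E n) : E n × E n :=
  (condMean A y σ ρ (langevinMean g β ρ γ v), langevinMean g β ρ γ v)

/-- The law of the noise that a sweep adds to `sweepMean`. -/
def sweepNoise (A : Matrix (Fin d) (Fin n) ℝ) (σ ρ γ : ℝ) : Measure (E n × E n) :=
  ((multivariateGaussian 0 ((2 * γ) • (1 : Matrix (Fin n) (Fin n) ℝ))).prod
    (multivariateGaussian 0 (precision A σ ρ)⁻¹)).map
      fun q => (condMeanCLM A σ ρ q.1 + q.2, q.1)

instance (A : Matrix (Fin d) (Fin n) ℝ) (σ ρ γ : ℝ) :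
    IsProbabilityMeasure (sweepNoise A σ ρ γ) :=
  Measure.isProbabilityMeasure_map (by fun_prop)

theorem memLp_sweepNoise (A : Matrix (Fin d) (Fin n) ℝ) (σ ρ γ : ℝ) :
    MemLp id 2 (sweepNoise A σ ρ γ) := by
  refine (memLp_map_measure_iff aestronglyMeasurable_id (by fun_prop)).2 ?_
  set G := multivariateGaussian (0 : E n) ((2 * γ) • (1 : Matrix (Fin n) (Fin n) ℝ))
  set H := multivariateGaussian (0 : E n) (precision A σ ρ)⁻¹
  have h1 : MemLp Prod.fst 2 (G.prod H) :=
    (IsGaussian.memLp_id G 2 (by simp)).comp_measurePreserving measurePreserving_fst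
  have h2 : MemLp Prod.snd 2 (G.prod H) :=
    (IsGaussian.memLp_id H 2 (by simp)).comp_measurePreserving measurePreserving_snd
  exact memLp_prod_iff.2 ⟨((condMeanCLM A σ ρ).comp_memLp' h1).add h2, h1⟩

theorem gaussianKernel_apply (S : Matrix (Fin n) (Fin n) ℝ) (a : E n) :
    gaussianKernel S a = (multivariateGaussian 0 S).map fun e => a + e := by
  change multivariateGaussian a S = _
  rw [multivariateGaussian, multivariateGaussian, Measure.map_map (by fun_prop) (by fun_prop)]
  congr 1
  ext x
  simp

theorem measurable_sweepMean (A : Matrix (Fin d) (Fin n) ℝ) (y : E d) (g : E n → ℝ)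
    (σ β ρ γ : ℝ) : Measurable (sweepMean A y g σ β ρ γ) :=
  ((measurable_condMean A y σ ρ).comp (measurable_langevinMean g β ρ γ)).prodMk
    (measurable_langevinMean g β ρ γ)

instance (S : Matrix (Fin n) (Fin n) ℝ) : IsMarkovKernel (gaussianKernel S) :=
  ⟨fun a => by
    change IsProbabilityMeasure (multivariateGaussian a S)
    infer_instance⟩

instance (A : Matrix (Fin d) (Fin n) ℝ) (y : E d) (σ ρ : ℝ) :
    IsMarkovKernel (xKernel A y σ ρ) := by
  unfold xKernel
  infer_instance

/-- Since the conditional mean is affine, the Langevin noise passes through it linearly and joins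
the noise of the exact draw. -/
theorem sweep_apply (A : Matrix (Fin d) (Fin n) ℝ) (y : E d) (g : E n → ℝ) (σ β ρ γ : ℝ)
    (v : E n × E n) :
    ((xKernel A y σ ρ ×ₖ Kernel.id) ∘ₖ zKernel g β ρ γ) v
      = (sweepNoise A σ ρ γ).map fun e => sweepMean A y g σ β ρ γ v + e := by
  ext s hs
  have hmc := measurable_condMean A y σ ρ
  have hmeas : MeasurableSet {q : E n × E n | sweepMean A y g σ β ρ γ v
      + (condMeanCLM A σ ρ q.1 + q.2, q.1) ∈ s} := by
    have : Measurable fun q : E n × E n => sweepMean A y g σ β ρ γ v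
      + (condMeanCLM A σ ρ q.1 + q.2, q.1) := by fun_prop
    exact this hs
  have hz : zKernel g β ρ γ v = (multivariateGaussian 0 ((2 * γ) • 1)).map
      fun e => langevinMean g β ρ γ v + e := by
    rw [zKernel, Kernel.comap_apply, gaussianKernel_apply]
  rw [Kernel.comp_apply' _ _ _ hs, hz, lintegral_map (Kernel.measurable_coe _ hs) (by fun_prop),
    sweepNoise, Measure.map_map (by fun_prop) (by fun_prop),
    Measure.map_apply (by fun_prop) hs]
  refine Eq.trans ?_ (Measure.prod_apply hmeas).symm
  refine lintegral_congr fun e => ?_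
  have hpm : Measurable fun x : E n => (x, langevinMean g β ρ γ v + e) := by fun_prop
  rw [Kernel.prod_apply, Kernel.id_apply, Measure.prod_dirac, Measure.map_apply hpm hs,
    xKernel, Kernel.comap_apply, gaussianKernel_apply, Measure.map_apply (by fun_prop) (hpm hs)]
  congr 1
  ext x
  simp [sweepMean, condMean_add, add_assoc]

/-- The Euclidean structure on pairs is linearly homeomorphic to the product structure. -/
def stateEquiv (n : ℕ) : (E n × E n) ≃L[ℝ] State n :=
  (WithLp.prodContinuousLinearEquiv 2 ℝ (E n) (E n)).symm

theorem kernel_apply (A : Matrix (Fin d) (Fin n) ℝ) (y : E d) (g : E n → ℝ) (σ β ρ γ : ℝ)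
    (v : State n) :
    kernel A y g σ β ρ γ v = ((sweepNoise A σ ρ γ).map (stateEquiv n)).map
      fun e => stateEquiv n (sweepMean A y g σ β ρ γ ((stateEquiv n).symm v)) + e := by
  have he : Measurable (stateEquiv n) := (stateEquiv n).continuous.measurable
  have hL : Measurable (WithLp.toLp 2 : E n × E n → State n) := WithLp.measurable_toLp 2 _
  rw [kernel, Kernel.comap_apply, Kernel.map_apply _ hL, sweep_apply,
    Measure.map_map hL (by fun_prop), Measure.map_map (by fun_prop) he]
  rfl

end Sweep

/-! ### Contraction estimates in the supremum and Euclidean norms -/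

section Contraction

variable {n d : ℕ} {g : E n → ℝ} {β ρ γ M_g m_g : ℝ}

theorem langevin_factor_nonneg [Nontrivial (E n)] (hβ : 0 < β) (hρ : 0 < ρ) (hγ : 0 < γ)
    (hM : 0 < M_g) (hg : ContDiff ℝ 2 g) (hgM : ∀ z, ‖hessian g z‖ ≤ M_g)
    (hgm : ∀ z w, m_g * ‖w‖ ^ 2 ≤ ⟪hessian g z w, w⟫)
    (hγle : γ ≤ (β * M_g + 1 / ρ ^ 2)⁻¹) : 0 ≤ 1 - γ / ρ ^ 2 - γ * β * m_g := by
  obtain ⟨u, hu⟩ := exists_ne (0 : E n)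
  have h := (norm_nonneg _).trans (norm_gradient_step_sub_le hβ hρ hγ hM hg hgM hgm hγle u 0)
  rw [sub_zero] at h
  exact nonneg_of_mul_nonneg_left h (norm_pos_iff.2 hu)

/-- The Langevin mean contracts from the supremum norm on pairs. -/
theorem norm_langevinMean_sub_le_max (hβ : 0 < β) (hρ : 0 < ρ) (hγ : 0 < γ) (hM : 0 < M_g)
    (hg : ContDiff ℝ 2 g) (hgM : ∀ z, ‖hessian g z‖ ≤ M_g)
    (hgm : ∀ z w, m_g * ‖w‖ ^ 2 ≤ ⟪hessian g z w, w⟫)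
    (hγle : γ ≤ (β * M_g + 1 / ρ ^ 2)⁻¹) (v w : E n × E n) :
    ‖langevinMean g β ρ γ v - langevinMean g β ρ γ w‖ ≤ (1 - γ * β * m_g) * ‖v - w‖ := by
  rcases subsingleton_or_nontrivial (E n) with hn | hn
  · simp [Subsingleton.elim v w]
  have h0 := langevin_factor_nonneg hβ hρ hγ hM hg hgM hgm hγle
  calc _ ≤ (1 - γ / ρ ^ 2 - γ * β * m_g) * ‖v.2 - w.2‖ + γ / ρ ^ 2 * ‖v.1 - w.1‖ :=
        norm_langevinMean_sub_le hβ hρ hγ hM hg hgM hgm hγle v w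
    _ ≤ (1 - γ / ρ ^ 2 - γ * β * m_g) * ‖v - w‖ + γ / ρ ^ 2 * ‖v - w‖ := by
        gcongr
        · exact norm_snd_le (v - w)
        · exact norm_fst_le (v - w)
    _ = _ := by ring

/-- Convexity of the square, with both weights then bounded by one. -/
theorem sq_convex_comb_le {a : ℝ} (h0 : 0 ≤ a) (h1 : a ≤ 1) (p q : ℝ) :
    ((1 - a) * p + a * q) ^ 2 ≤ q ^ 2 + p ^ 2 := by
  linarith [mul_nonneg (mul_nonneg h0 (sub_nonneg.2 h1)) (sq_nonneg (p - q)),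
    mul_nonneg h0 (sq_nonneg p), mul_nonneg (sub_nonneg.2 h1) (sq_nonneg q)]

/-- The Langevin mean does not expand the Euclidean norm on pairs. -/
theorem sq_norm_langevinMean_sub_le (hβ : 0 < β) (hρ : 0 < ρ) (hγ : 0 < γ) (hM : 0 < M_g)
    (hm : 0 < m_g) (hg : ContDiff ℝ 2 g) (hgM : ∀ z, ‖hessian g z‖ ≤ M_g)
    (hgm : ∀ z w, m_g * ‖w‖ ^ 2 ≤ ⟪hessian g z w, w⟫)
    (hγle : γ ≤ (β * M_g + 1 / ρ ^ 2)⁻¹) (v w : E n × E n) :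
    ‖langevinMean g β ρ γ v - langevinMean g β ρ γ w‖ ^ 2
      ≤ ‖v.1 - w.1‖ ^ 2 + ‖v.2 - w.2‖ ^ 2 := by
  have ha0 : 0 ≤ γ / ρ ^ 2 := by positivity
  have ha1 : γ / ρ ^ 2 ≤ 1 := div_sq_le_one hβ hρ hM hγle
  have hb : 0 ≤ γ * β * m_g := by positivity
  have h := norm_langevinMean_sub_le hβ hρ hγ hM hg hgM hgm hγle v w
  have h' : ‖langevinMean g β ρ γ v - langevinMean g β ρ γ w‖
      ≤ (1 - γ / ρ ^ 2) * ‖v.2 - w.2‖ + γ / ρ ^ 2 * ‖v.1 - w.1‖ := by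
    linarith [mul_nonneg hb (norm_nonneg (v.2 - w.2))]
  exact (pow_le_pow_left₀ (norm_nonneg _) h' 2).trans (sq_convex_comb_le ha0 ha1 _ _)

/-- In the supremum norm the `x` component costs nothing: it is the image of the `z` component under
an affine map with linear part of norm at most one. -/
theorem norm_sweepMean_sub_le (A : Matrix (Fin d) (Fin n) ℝ) (y : E d) (σ : ℝ) (hρ : 0 < ρ)
    (v w : E n × E n) :
    ‖sweepMean A y g σ β ρ γ v - sweepMean A y g σ β ρ γ w‖
      ≤ ‖langevinMean g β ρ γ v - langevinMean g β ρ γ w‖ := by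
  rw [Prod.norm_def]
  refine max_le ?_ le_rfl
  simp only [sweepMean, Prod.fst_sub]
  rw [condMean_sub]
  exact ((condMeanCLM A σ ρ).le_of_opNorm_le (norm_condMeanCLM_le A σ hρ) _).trans_eq (one_mul _)

theorem lipschitzWith_sweepMean (A : Matrix (Fin d) (Fin n) ℝ) (y : E d) (σ : ℝ) (hβ : 0 < β)
    (hρ : 0 < ρ) (hγ : 0 < γ) (hM : 0 < M_g)
    (hg : ContDiff ℝ 2 g) (hgM : ∀ z, ‖hessian g z‖ ≤ M_g)
    (hgm : ∀ z w, m_g * ‖w‖ ^ 2 ≤ ⟪hessian g z w, w⟫)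
    (hγle : γ ≤ (β * M_g + 1 / ρ ^ 2)⁻¹) :
    LipschitzWith (1 - γ * β * m_g).toNNReal (sweepMean A y g σ β ρ γ) := by
  refine LipschitzWith.of_dist_le_mul fun v w => ?_
  rw [dist_eq_norm, dist_eq_norm]
  calc _ ≤ _ := norm_sweepMean_sub_le A y σ hρ v w
    _ ≤ (1 - γ * β * m_g) * ‖v - w‖ :=
        norm_langevinMean_sub_le_max hβ hρ hγ hM hg hgM hgm hγle v w
    _ ≤ _ := by
        gcongr
        exact Real.le_coe_toNNReal _

theorem edist_sq_eq_ofReal {Y : Type*} [SeminormedAddCommGroup Y] (a b : Y) :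
    edist a b ^ 2 = ENNReal.ofReal (‖a - b‖ ^ 2) := by
  rw [edist_dist, dist_eq_norm, ENNReal.ofReal_pow (norm_nonneg _)]

theorem norm_stateEquiv_sub_sq (v w : E n × E n) :
    ‖stateEquiv n v - stateEquiv n w‖ ^ 2 = ‖v.1 - w.1‖ ^ 2 + ‖v.2 - w.2‖ ^ 2 := by
  rw [WithLp.prod_norm_sq_eq_of_L2]
  rfl

theorem stateEquiv_sweepMean_sub_sq_le (A : Matrix (Fin d) (Fin n) ℝ) (y : E d) (σ : ℝ)
    (v w : E n × E n) :
    ‖stateEquiv n (sweepMean A y g σ β ρ γ v) - stateEquiv n (sweepMean A y g σ β ρ γ w)‖ ^ 2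
      ≤ C1 A σ ρ * ‖langevinMean g β ρ γ v - langevinMean g β ρ γ w‖ ^ 2 := by
  rw [norm_stateEquiv_sub_sq]
  change ‖condMean A y σ ρ _ - condMean A y σ ρ _‖ ^ 2
    + ‖langevinMean g β ρ γ v - langevinMean g β ρ γ w‖ ^ 2 ≤ _
  rw [condMean_sub]
  have h := pow_le_pow_left₀ (norm_nonneg _) ((condMeanCLM A σ ρ).le_opNorm
    (langevinMean g β ρ γ v - langevinMean g β ρ γ w)) 2
  rw [mul_pow] at h
  change _ ≤ (1 + ‖condMeanCLM A σ ρ‖ ^ 2) * _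
  linarith

end Contraction

end LwSGS

end

theorem proposition2 {n d : ℕ} (A : Matrix (Fin d) (Fin n) ℝ) (y : LwSGS.E d)
    (g : LwSGS.E n → ℝ) (σ β ρ γ M_g m_g : ℝ)
    (hσ : 0 < σ) (hβ : 0 < β) (hρ : 0 < ρ) (hγ : 0 < γ)
    (hM : 0 < M_g) (hm : 0 < m_g)
    (hg : ContDiff ℝ 2 g)
    (hgM : ∀ z, ‖LwSGS.hessian g z‖ ≤ M_g)
    (hgm : ∀ z w, m_g * ‖w‖ ^ 2 ≤ ⟪LwSGS.hessian g z w, w⟫)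
    (hγle : γ ≤ (β * M_g + 1 / ρ ^ 2)⁻¹) :
    ∃ π : Measure (LwSGS.State n),
      IsProbabilityMeasure π ∧
      (LwSGS.kernel A y g σ β ρ γ).Invariant π ∧
      (∀ π' : Measure (LwSGS.State n), IsProbabilityMeasure π' →
        (LwSGS.kernel A y g σ β ρ γ).Invariant π' → π' = π) ∧
      MemLp id 2 π ∧
      ∀ (v : LwSGS.State n) (t : ℕ), 1 ≤ t →
        MemLp id 2 ((LwSGS.kernel A y g σ β ρ γ ^ t) ∘ₘ Measure.dirac v) ∧
        LwSGS.W2 ((LwSGS.kernel A y g σ β ρ γ ^ t) ∘ₘ Measure.dirac v) π ^ 2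
          ≤ ENNReal.ofReal (LwSGS.C1 A σ ρ * (1 - γ * β * m_g) ^ (2 * (t - 1)))
            * LwSGS.W2 (Measure.dirac v) π ^ 2 := by
  open LwSGS in
  let S := sweepMean A y g σ β ρ γ
  let e := stateEquiv n
  let D : State n → State n := fun v => e (S (e.symm v))
  let η := (sweepNoise A σ ρ γ).map e
  have hSm : Measurable S := measurable_sweepMean A y g σ β ρ γ
  have hLm := measurable_langevinMean g β ρ γ
  have he : Measurable e := e.continuous.measurable
  have he' : Measurable e.symm := e.symm.continuous.measurable
  have hDm : Measurable D := by fun_prop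
  have hSl := lipschitzWith_sweepMean A y σ hβ hρ hγ hM hg hgM hgm hγle
  have hK : (1 - γ * β * m_g).toNNReal < 1 := by
    rw [Real.toNNReal_lt_one]
    linarith [mul_pos (mul_pos hγ hβ) hm]
  have hκ : ∀ v, kernel A y g σ β ρ γ v = η.map fun x => D v + x :=
    kernel_apply A y g σ β ρ γ
  have hηp : IsProbabilityMeasure η := Measure.isProbabilityMeasure_map he.aemeasurable
  have hmap : ∀ μ : Measure (E n × E n), MemLp id 2 μ → MemLp id 2 (μ.map e) := fun μ hμ =>
    (memLp_map_measure_iff aestronglyMeasurable_id he.aemeasurable).2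
      ((e : E n × E n →L[ℝ] State n).comp_memLp' hμ)
  have hη : MemLp id 2 η := hmap _ (memLp_sweepNoise A σ ρ γ)
  have hDl : ∃ K, LipschitzWith K D :=
    -- Any constant will do here: it serves only to propagate second moments.
    ⟨_, (e.lipschitz.comp hSl).comp e.symm.lipschitz⟩
  obtain ⟨K, hDl⟩ := hDl
  obtain ⟨ν, hνp, hν2, hνS⟩ :=
    exists_arStep_eq hK hSl (sweepNoise A σ ρ γ) (memLp_sweepNoise A σ ρ γ)
  have hπp : IsProbabilityMeasure (ν.map e) := Measure.isProbabilityMeasure_map he.aemeasurable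
  have hπ : arStep D η (ν.map e) = ν.map e := by
    rw [arStep_map e hSm, hνS]
  refine ⟨ν.map e, hπp, ?_, fun π' hπ' hinv => ?_, hmap ν hν2, fun v t ht => ?_⟩
  · rw [Kernel.Invariant, comp_eq_arStep hDm hκ, hπ]
  · rw [Kernel.Invariant, comp_eq_arStep hDm hκ] at hinv
    have hback : (π'.map e.symm).map e = π' := by
      rw [Measure.map_map he he']
      simp
    have hp : IsProbabilityMeasure (π'.map e.symm) :=
      Measure.isProbabilityMeasure_map he'.aemeasurable
    have h1 : (arStep S (sweepNoise A σ ρ γ) (π'.map e.symm)).map e = π' := by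
      rw [← arStep_map e hSm, hback]
      exact hinv
    have h2 : arStep S (sweepNoise A σ ρ γ) (π'.map e.symm) = π'.map e.symm := by
      conv_rhs => rw [← h1]
      rw [Measure.map_map he' he]
      simp
    rw [← hback, eq_of_arStep_eq hK hSl _ h2 hνS]
  · obtain ⟨s, rfl⟩ : ∃ s, t = s + 1 := ⟨t - 1, by omega⟩
    rw [pow_comp_eq_arStep_iterate hDm hκ]
    have hdirac : MemLp id 2 (Measure.dirac v) :=
      (memLp_const v).ae_eq (ae_eq_dirac id).symm
    refine ⟨memLp_id_arStep_iterate hDl η _ hη hdirac _, ?_⟩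
    let J : State n × State n → ℝ≥0∞ := fun p =>
      edist (langevinMean g β ρ γ (e.symm p.1)) (langevinMean g β ρ γ (e.symm p.2)) ^ 2
    have hJ : Measurable J := by fun_prop
    have hC : 0 ≤ C1 A σ ρ := by
      unfold C1
      positivity
    have hW := W2_sq_arStep_iterate_le hDm η (Measure.dirac v) (ν.map e) hJ
      (c := ENNReal.ofReal ((1 - γ * β * m_g) ^ 2)) (C := ENNReal.ofReal (C1 A σ ρ))
      ENNReal.ofReal_ne_top ENNReal.ofReal_ne_top (fun a b x => ?_) (fun a b => ?_)
      (fun a b => ?_) s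
    · rw [Function.iterate_fixed hπ] at hW
      rwa [Nat.add_sub_cancel, ENNReal.ofReal_mul hC, pow_mul, ENNReal.ofReal_pow (sq_nonneg _)]
    · simp only [J]
      rw [edist_sq_eq_ofReal, edist_sq_eq_ofReal, ← ENNReal.ofReal_mul (sq_nonneg _)]
      refine ENNReal.ofReal_le_ofReal ?_
      -- The supremum norm of the sweep difference is the intermediate quantity: `h1` bounds the new
      -- Langevin difference by it with the contraction factor, `h2` bounds it by the old one.
      have h1 := norm_langevinMean_sub_le_max hβ hρ hγ hM hg hgM hgm hγle
        (e.symm (D a + x)) (e.symm (D b + x))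
      have h2 := norm_sweepMean_sub_le (g := g) (β := β) (γ := γ) A y σ hρ (e.symm a) (e.symm b)
      rw [← map_sub, add_sub_add_right_eq_sub, ← map_sub, e.symm_apply_apply] at h1
      refine (pow_le_pow_left₀ (norm_nonneg _) h1 2).trans ?_
      rw [mul_pow]
      gcongr
    · simp only [J]
      rw [edist_sq_eq_ofReal, edist_sq_eq_ofReal]
      refine ENNReal.ofReal_le_ofReal ?_
      have h := norm_stateEquiv_sub_sq (e.symm a) (e.symm b)
      rw [e.apply_symm_apply, e.apply_symm_apply] at h
      rw [h]
      exact sq_norm_langevinMean_sub_le hβ hρ hγ hM hm hg hgM hgm hγle _ _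
    · simp only [J]
      rw [edist_sq_eq_ofReal, edist_sq_eq_ofReal, ← ENNReal.ofReal_mul hC]
      exact ENNReal.ofReal_le_ofReal (stateEquiv_sweepMean_sub_sq_le A y σ _ _)
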